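/- Let $n \ge 1$ be an integer and let $b_n(u) = B_n(u)/n!$, where $B_n$ is the $n$th Bernoulli polynomial. For $1 \le k \le 2n$ let \[ f_{k:2n}(u) = \frac{(2n)!}{(k-1)!\,(2n-k)!}\, u^{k-1}(1-u)^{2n-k} \] be the normalized Bernstein polynomial of degree $2n-1$, that is, the beta$(k,2n+1-k)$ density on $(0,1)$. The \emph{Bernoulli clock}: let $U_1,U_1',\dots,U_n,U_n'$ be $2n$ i.i.d. random variables, uniform on $[0,1)$, regarded as points of the circle $\mathbb{R}/\mathbb{Z}=[0,1)$. Starting from the origin $0$, move clockwise (in the direction of increasing numbers, modulo $1$) to the first point encountered of the pair $\{U_1,U_1'\}$, from there clockwise to the first point encountered of the pair $\{U_2,U_2'\}$, and so on, until the first point encountered of the pair $\{U_n,U_n'\}$ is reached. Let $I_n \in \{1,\dots,2n\}$ be the rank of this last point when all $2n$ points are listed in increasing order $U_{1:2n} < \dots < U_{2n:2n}$ (the points are almost surely distinct), so that the clock stops at $U_{I_n:2n}$. Let $S_n$ be the sum of $n$ independent beta$(1,2)$ random variables (each with density $2(1-x)$ on $(0,1)$). Then the index $I_n$ is a random variable with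 values in $\{1,\dots,2n\}$, and the fractional part $S_n^\circ = S_n - \lfloor S_n \rfloor$ has a probability density on $(0,1)$, which is given by \[ f_{S_n^\circ}(u) \;=\; 1 - 2^n b_n(u) \;=\; \sum_{k=1}^{2n} \mathbb{P}(I_n = k)\, f_{k:2n}(u), \qquad u \in (0,1). \] -/

import Mathlib

open MeasureTheory ProbabilityTheory
open scoped Nat

noncomputable section

/-- The factorially normalized Bernoulli polynomial `b_n(x) = B_n(x) / n!`. -/
def normBernoulli (n : ℕ) (x : ℝ) : ℝ :=
  bernoulliFun n x / (n ! : ℝ)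

/-- The normalized Bernstein polynomial
`f_{k:N}(u) = N! / ((k-1)! (N-k)!) u^(k-1) (1-u)^(N-k)` for `1 ≤ k ≤ N`,
that is, the density of the beta(k, N+1-k) distribution. -/
def normBernstein (k N : ℕ) (u : ℝ) : ℝ :=
  (N ! : ℝ) / (((k - 1)! : ℝ) * ((N - k)! : ℝ)) * u ^ (k - 1) * (1 - u) ^ (N - k)

/-- Of two points `a`, `b` of the circle `[0,1)`, the one that is met first when moving clockwise
(in the direction of increasing numbers, modulo `1`) from the point `p`: the clockwise distance
from `p` to `a` is the fractional part of `a - p`. -/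
def firstClockwise (p a b : ℝ) : ℝ :=
  if Int.fract (a - p) ≤ Int.fract (b - p) then a else b

/-- The place on the circle where the Bernoulli clock with the `n` pairs of points
`u (i, 0)`, `u (i, 1)` stops: start at the origin `0`, move clockwise to the first point of the
first pair, from there clockwise to the first point of the second pair, and so on, until the
first point of the last pair is met. -/
def clockStop : (n : ℕ) → (Fin n × Fin 2 → ℝ) → ℝ
  | 0, _ => 0
  | n + 1, u =>
      firstClockwise (clockStop n (fun ij => u (ij.1.castSucc, ij.2)))
        (u (Fin.last n, 0)) (u (Fin.last n, 1))

/-- The index `I_n` at which the Bernoulli clock stops: the rank of the stopping place among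
all `2n` points, listed in increasing order. If the points are distinct, this is the index `k` for
which the `k`-th order statistic of the `2n` points is the stopping place. -/
def clockIndex (n : ℕ) (u : Fin n × Fin 2 → ℝ) : ℕ :=
  (Finset.univ.filter (fun ij : Fin n × Fin 2 => u ij ≤ clockStop n u)).card

end

/-! The law of the place where the clock stops is computed in two ways. As a random walk: seen from
any position `p`, the clockwise distance to the first point of a fresh uniform pair is the minimum
of two uniforms, hence beta(1,2) whatever `p` is (`map_firstClockwise`). The stopping place and the
fractional part of the beta sum therefore share the law `clockLaw n`. One more step is a circular
convolution with the kernel `2 * (1 - x)`; integration by parts and `b_{n+1}' = b_n` show that it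
sends `1 - 2^n b_n` to `1 - 2^(n+1) b_{n+1}` (`integral_clockDensity_convolution`). As an order
statistic: the index depends only on the relative order of the points, and that order is independent
of their sorted values because the points are exchangeable. Given index `k`, the stopping place is
thus distributed as the `k`-th order statistic, with density `f_{k:2n}`; averaging over permutations
gives the mixture formula (`lintegral_clockStop`). The two densities agree almost everywhere, and on
`(0,1)` everywhere by continuity. -/

/-! ### Uniform and beta(1,2) laws, and one move of the clock. -/

/-- Lebesgue measure on `[0,1)`. -/
noncomputable def unitMeasure : Measure ℝ := volume.restrict (Set.Ico 0 1)

instance : IsProbabilityMeasure unitMeasure := ⟨by simp [unitMeasure]⟩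

theorem ae_unitMeasure_mem : ∀ᵐ x ∂unitMeasure, x ∈ Set.Ico (0 : ℝ) 1 :=
  ae_restrict_mem measurableSet_Ico

instance : NullSingletonClass unitMeasure := by unfold unitMeasure; infer_instance

theorem map_eq_unitMeasure_of_isUniform {Ω : Type*} [MeasurableSpace Ω] {P : Measure Ω}
    {X : Ω → ℝ} (hX : pdf.IsUniform X (Set.Ico (0 : ℝ) 1) P volume) :
    P.map X = unitMeasure := by
  rw [hX, ProbabilityTheory.cond, unitMeasure]
  simp

theorem betaMeasure_one_two :
    betaMeasure 1 2 = unitMeasure.withDensity (fun x => ENNReal.ofReal (2 * (1 - x))) := by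
  have hb : ProbabilityTheory.beta 1 2 = 1 / 2 := by
    have h3 : Real.Gamma (1 + 2) = 2 := by
      have := Real.Gamma_nat_eq_factorial 2
      norm_num [Nat.factorial] at this ⊢
    rw [ProbabilityTheory.beta, h3, Real.Gamma_one, Real.Gamma_two, mul_one]
  rw [betaMeasure, unitMeasure, ← restrict_Ioo_eq_restrict_Ico,
    ← withDensity_indicator measurableSet_Ioo]
  congr 1
  ext x
  by_cases hx : x ∈ Set.Ioo (0 : ℝ) 1
  · rw [Set.indicator_of_mem hx, betaPDF_of_pos_lt_one hx.1 hx.2, hb]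
    norm_num
  · rw [Set.indicator_of_notMem hx, betaPDF_eq, if_neg (by simpa using hx), ENNReal.ofReal_zero]

theorem lintegral_betaMeasure_one_two {f : ℝ → ENNReal} (hf : Measurable f) :
    ∫⁻ x, f x ∂(betaMeasure 1 2) = ∫⁻ x, ENNReal.ofReal (2 * (1 - x)) * f x ∂unitMeasure := by
  rw [betaMeasure_one_two, lintegral_withDensity_eq_lintegral_mul _ (by fun_prop) hf]
  rfl

instance : IsProbabilityMeasure (betaMeasure 1 2) :=
  isProbabilityMeasureBeta one_pos two_pos

/-- `(0,1]` and `(p,p+1]` are both fundamental domains for the integer translations, so a 1-periodic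
function has the same integral over each. -/
theorem measurePreserving_fract_add (p : ℝ) :
    MeasurePreserving (fun x => Int.fract (p + x)) unitMeasure unitMeasure := by
  have hm : Measurable (fun x : ℝ => Int.fract (p + x)) := by fun_prop
  refine ⟨hm, Measure.ext_of_lintegral _ fun f hf => ?_⟩
  rw [lintegral_map hf hm]
  have hI (g : ℝ → ENNReal) : ∫⁻ x, g x ∂unitMeasure = ∫⁻ x in Set.Ioc (0 : ℝ) 1, g x := by
    rw [unitMeasure, restrict_Ico_eq_restrict_Ioc]
  have h1 := (isAddFundamentalDomain_Ioc one_pos p).setLIntegral_eq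
    (isAddFundamentalDomain_Ioc (one_pos (α := ℝ)) 0) (fun x => f (Int.fract x)) (by
      rintro ⟨g, hg⟩ x
      obtain ⟨k, rfl⟩ := AddSubgroup.mem_zmultiples_iff.1 hg
      simp [AddSubgroup.vadd_def, add_comm])
  rw [hI]
  have h2 : ∫⁻ x in Set.Ioc (0 : ℝ) 1, f (Int.fract (p + x)) =
      ∫⁻ x in Set.Ioc p (p + 1), f (Int.fract x) := by
    have := (measurePreserving_add_left (volume : Measure ℝ) p).setLIntegral_comp_preimage_emb
      (measurableEmbedding_addLeft p) (fun x => f (Int.fract x)) (Set.Ioc p (p + 1))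
    rw [← this]
    simp
  rw [h2, h1, zero_add, ← hI]
  refine lintegral_congr_ae ?_
  filter_upwards [ae_unitMeasure_mem] with x hx
  rw [Int.fract_eq_self.2 hx]

theorem fract_fract_add_sub_cancel {p x : ℝ} (hx : x ∈ Set.Ico (0 : ℝ) 1) :
    Int.fract (Int.fract (p + x) - p) = x := by
  rw [show Int.fract (p + x) - p = x - (⌊p + x⌋ : ℤ) by unfold Int.fract; ring,
    Int.fract_sub_intCast, Int.fract_eq_self.2 hx]

/-- Cut the square along the diagonal: on each half the minimum is one coordinate `x`, and the other
ranges over a set of length `1 - x`. The two halves give the factor 2. -/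
theorem map_min_unitMeasure :
    (unitMeasure.prod unitMeasure).map (fun z => min z.1 z.2) = betaMeasure 1 2 := by
  refine Measure.ext_of_lintegral _ fun f hf => ?_
  rw [lintegral_map hf (by fun_prop), lintegral_betaMeasure_one_two hf]
  have hsplit : ∀ z : ℝ × ℝ, f (min z.1 z.2) =
      {z : ℝ × ℝ | z.1 ≤ z.2}.indicator (fun z => f z.1) z +
      {z : ℝ × ℝ | z.2 < z.1}.indicator (fun z => f z.2) z := by
    intro z
    rcases le_or_gt z.1 z.2 with h | h
    · simp [h, h.not_gt]
    · simp [h, h.le, h.not_ge]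
  have hm1 : MeasurableSet {z : ℝ × ℝ | z.1 ≤ z.2} :=
    measurableSet_le measurable_fst measurable_snd
  have hm2 : MeasurableSet {z : ℝ × ℝ | z.2 < z.1} :=
    measurableSet_lt measurable_snd measurable_fst
  have hf1 : Measurable ({z : ℝ × ℝ | z.1 ≤ z.2}.indicator (fun z => f z.1)) :=
    (hf.comp measurable_fst).indicator hm1
  have hf2 : Measurable ({z : ℝ × ℝ | z.2 < z.1}.indicator (fun z => f z.2)) :=
    (hf.comp measurable_snd).indicator hm2
  simp_rw [hsplit]
  rw [lintegral_add_left hf1, lintegral_prod _ hf1.aemeasurable,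
    lintegral_prod_symm _ hf2.aemeasurable]
  have hA : ∀ x ∈ Set.Ico (0 : ℝ) 1,
      ∫⁻ y, {z : ℝ × ℝ | z.1 ≤ z.2}.indicator (fun z => f z.1) (x, y) ∂unitMeasure =
        ENNReal.ofReal (1 - x) * f x := by
    intro x hx
    have : (fun y => {z : ℝ × ℝ | z.1 ≤ z.2}.indicator (fun z => f z.1) (x, y)) =
        (Set.Ici x).indicator (fun _ => f x) := by
      ext y; simp [Set.indicator]
    rw [this, lintegral_indicator_const measurableSet_Ici, unitMeasure,
      Measure.restrict_apply measurableSet_Ici, mul_comm]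
    have : Set.Ici x ∩ Set.Ico 0 1 = Set.Ico x 1 := by
      ext y; simp only [Set.mem_inter_iff, Set.mem_Ici, Set.mem_Ico]
      exact ⟨fun h => ⟨h.1, h.2.2⟩, fun h => ⟨h.1, hx.1.trans h.1, h.2⟩⟩
    rw [this, Real.volume_Ico]
  have hB : ∀ x ∈ Set.Ico (0 : ℝ) 1,
      ∫⁻ y, {z : ℝ × ℝ | z.2 < z.1}.indicator (fun z => f z.2) (y, x) ∂unitMeasure =
        ENNReal.ofReal (1 - x) * f x := by
    intro x hx
    have : (fun y => {z : ℝ × ℝ | z.2 < z.1}.indicator (fun z => f z.2) (y, x)) =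
        (Set.Ioi x).indicator (fun _ => f x) := by
      ext y; simp [Set.indicator]
    rw [this, lintegral_indicator_const measurableSet_Ioi, unitMeasure,
      Measure.restrict_apply measurableSet_Ioi, mul_comm]
    have : Set.Ioi x ∩ Set.Ico 0 1 = Set.Ioo x 1 := by
      ext y; simp only [Set.mem_inter_iff, Set.mem_Ioi, Set.mem_Ico, Set.mem_Ioo]
      exact ⟨fun h => ⟨h.1, h.2.2⟩, fun h => ⟨h.1, hx.1.trans h.1.le, h.2⟩⟩
    rw [this, Real.volume_Ioo]
  rw [← lintegral_add_left hf1.lintegral_prod_right']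
  refine lintegral_congr_ae ?_
  filter_upwards [ae_unitMeasure_mem] with x hx
  rw [hA x hx, hB x hx, ← two_mul, ← mul_assoc, ENNReal.ofReal_mul two_pos.le]
  simp

theorem measurable_firstClockwise :
    Measurable (fun z : ℝ × ℝ × ℝ => firstClockwise z.1 z.2.1 z.2.2) := by
  unfold firstClockwise
  refine Measurable.ite (measurableSet_le ?_ ?_) ?_ ?_ <;> fun_prop

/-- Rotating both points by `p` preserves their joint law and turns clockwise distances from `p`
into the original coordinates, so the smaller coordinate decides. -/
theorem map_firstClockwise (p : ℝ) :
    (unitMeasure.prod unitMeasure).map (fun z => firstClockwise p z.1 z.2) =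
      (betaMeasure 1 2).map (fun x => Int.fract (p + x)) := by
  have hpres := (measurePreserving_fract_add p).prod (measurePreserving_fract_add p)
  have hm : Measurable (fun z : ℝ × ℝ => firstClockwise p z.1 z.2) :=
    measurable_firstClockwise.comp measurable_prodMk_left
  rw [← hpres.map_eq, Measure.map_map hm hpres.measurable, ← map_min_unitMeasure,
    Measure.map_map (by fun_prop) (by fun_prop)]
  refine Measure.map_congr ?_
  have hmem : ∀ᵐ z ∂unitMeasure.prod unitMeasure,
      z.1 ∈ Set.Ico (0 : ℝ) 1 ∧ z.2 ∈ Set.Ico (0 : ℝ) 1 :=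
    (Measure.quasiMeasurePreserving_fst.ae ae_unitMeasure_mem).and
      (Measure.quasiMeasurePreserving_snd.ae ae_unitMeasure_mem)
  filter_upwards [hmem] with z hz
  simp only [Function.comp, Prod.map, firstClockwise, fract_fract_add_sub_cancel hz.1,
    fract_fract_add_sub_cancel hz.2]
  split_ifs with h
  · rw [min_eq_left h]
  · rw [min_eq_right (le_of_not_ge h)]

/-! ### The random walk on the circle behind both the beta sum and the clock. -/

/-- The law of the stopping place of the Bernoulli clock with `n` pairs. -/
noncomputable def clockLaw : ℕ → Measure ℝ
  | 0 => Measure.dirac 0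
  | n + 1 => ((clockLaw n).prod (betaMeasure 1 2)).map (fun z => Int.fract (z.1 + z.2))

instance isProbabilityMeasure_clockLaw : ∀ n, IsProbabilityMeasure (clockLaw n)
  | 0 => by unfold clockLaw; infer_instance
  | n + 1 => by
    have := isProbabilityMeasure_clockLaw n
    unfold clockLaw
    exact Measure.isProbabilityMeasure_map (by fun_prop)

theorem lintegral_clockLaw_succ (n : ℕ) {f : ℝ → ENNReal} (hf : Measurable f) :
    ∫⁻ x, f x ∂(clockLaw (n + 1)) =
      ∫⁻ p, ∫⁻ x, f (Int.fract (p + x)) ∂(betaMeasure 1 2) ∂(clockLaw n) := by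
  rw [clockLaw, lintegral_map hf (by fun_prop), lintegral_prod]
  exact (hf.comp (by fun_prop)).aemeasurable

theorem map_fract_sum_eq_clockLaw (n : ℕ) {Ω : Type*} [MeasurableSpace Ω] {P : Measure Ω}
    [IsProbabilityMeasure P] {X : Fin n → Ω → ℝ} (hXm : ∀ i, Measurable (X i))
    (hX : ∀ i, P.map (X i) = betaMeasure 1 2) (hXi : iIndepFun X P) :
    P.map (fun ω => Int.fract (∑ i, X i ω)) = clockLaw n := by
  induction n with
  | zero => simp [clockLaw]
  | succ n ih =>
    have hi : IndepFun (fun ω => ∑ i : Fin n, X i.castSucc ω) (X (Fin.last n)) P := by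
      have := (hXi.indepFun_finsetSum_of_notMem hXm
        (s := Finset.univ.map Fin.castSuccEmb) (i := Fin.last n) (by simp [Fin.castSucc_ne_last]))
      convert this using 1
      ext ω
      simp
    have hi' : IndepFun (fun ω => Int.fract (∑ i : Fin n, X i.castSucc ω)) (X (Fin.last n)) P :=
      hi.comp measurable_fract measurable_id
    have hm : Measurable (fun ω => Int.fract (∑ i : Fin n, X i.castSucc ω)) := by fun_prop
    have hprod := (indepFun_iff_map_prod_eq_prod_map_map hm.aemeasurable
      (hXm (Fin.last n)).aemeasurable).1 hi'
    rw [hX, ih (fun i => hXm _) (fun i => hX _)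
      (hXi.precomp (Fin.castSucc_injective n))] at hprod
    rw [clockLaw, ← hprod, Measure.map_map (by fun_prop) (by fun_prop)]
    congr 1
    ext ω
    simp only [Function.comp, Fin.sum_univ_castSucc]
    rw [Int.fract_eq_fract]
    refine ⟨⌊∑ i : Fin n, X i.castSucc ω⌋, ?_⟩
    unfold Int.fract
    ring

theorem measurable_clockStop : ∀ n : ℕ, Measurable (clockStop n)
  | 0 => by simp only [clockStop]; exact measurable_const
  | n + 1 => by
    have h1 : Measurable (fun u : Fin (n + 1) × Fin 2 → ℝ =>
        clockStop n (fun ij => u (ij.1.castSucc, ij.2))) :=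
      (measurable_clockStop n).comp (by fun_prop)
    exact measurable_firstClockwise.comp
      (h1.prodMk ((measurable_pi_apply _).prodMk (measurable_pi_apply _)))

/-- The last pair is independent of the earlier pairs, hence of the previous stopping place;
conditioning on that place `p` reduces the step to `map_firstClockwise`. -/
theorem map_clockStop_eq_clockLaw (n : ℕ) {Ω : Type*} [MeasurableSpace Ω] {Q : Measure Ω}
    [IsProbabilityMeasure Q] {U : Fin n × Fin 2 → Ω → ℝ} (hUm : ∀ i, Measurable (U i))
    (hU : ∀ i, Q.map (U i) = unitMeasure) (hUi : iIndepFun U Q) :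
    Q.map (fun ω => clockStop n (fun ij => U ij ω)) = clockLaw n := by
  induction n with
  | zero => simp [clockLaw, clockStop]
  | succ n ih =>
    let c : Fin n × Fin 2 → Fin (n + 1) × Fin 2 := fun ij => (ij.1.castSucc, ij.2)
    have hc : Function.Injective c := fun a b h => by
      simp only [c, Prod.mk.injEq, Fin.castSucc_inj] at h
      exact Prod.ext h.1 h.2
    let a : Fin (n + 1) × Fin 2 := (Fin.last n, 0)
    let b : Fin (n + 1) × Fin 2 := (Fin.last n, 1)
    have hS : ∀ ij, c ij ∈ Finset.univ.image c := by simp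
    have hi := hUi.indepFun_finset (Finset.univ.image c) {a, b} (by
      rw [Finset.disjoint_left]
      rintro x hx
      obtain ⟨ij, -, rfl⟩ := Finset.mem_image.1 hx
      simp [c, a, b, Fin.castSucc_ne_last]) hUm
    have hleft : Measurable (fun v : Finset.univ.image c → ℝ =>
        clockStop n (fun ij => v ⟨c ij, hS ij⟩)) := (measurable_clockStop n).comp (by fun_prop)
    have hright : Measurable (fun v : ({a, b} : Finset (Fin (n + 1) × Fin 2)) → ℝ =>
        (v ⟨a, by simp⟩, v ⟨b, by simp⟩)) := by fun_prop
    have hi2 : IndepFun (fun ω => clockStop n (fun ij => U (c ij) ω))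
        (fun ω => (U a ω, U b ω)) Q :=
      hi.comp hleft hright
    have hm1 : Measurable (fun ω => clockStop n (fun ij => U (c ij) ω)) :=
      (measurable_clockStop n).comp (by fun_prop)
    have hm2 : Measurable (fun ω => (U a ω, U b ω)) := (hUm a).prodMk (hUm b)
    have hab : IndepFun (U a) (U b) Q := hUi.indepFun (by simp [a, b])
    have hprod := (indepFun_iff_map_prod_eq_prod_map_map hm1.aemeasurable hm2.aemeasurable).1 hi2
    rw [ih (fun i => hUm _) (fun i => hU _) (hUi.precomp hc),
      (indepFun_iff_map_prod_eq_prod_map_map (hUm a).aemeasurable (hUm b).aemeasurable).1 hab,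
      hU, hU] at hprod
    have hF : (fun ω => clockStop (n + 1) (fun ij => U ij ω)) =
        (fun z : ℝ × ℝ × ℝ => firstClockwise z.1 z.2.1 z.2.2) ∘
          (fun ω => (clockStop n (fun ij => U (c ij) ω), (U a ω, U b ω))) := rfl
    rw [hF, ← Measure.map_map measurable_firstClockwise (hm1.prodMk hm2), hprod]
    refine Measure.ext_of_lintegral _ fun f hf => ?_
    have hfm : Measurable (fun z : ℝ × ℝ × ℝ => f (firstClockwise z.1 z.2.1 z.2.2)) :=
      hf.comp measurable_firstClockwise
    rw [lintegral_map hf measurable_firstClockwise, lintegral_clockLaw_succ n hf,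
      lintegral_prod _ hfm.aemeasurable]
    refine lintegral_congr fun p => ?_
    have hmp : Measurable (fun z : ℝ × ℝ => firstClockwise p z.1 z.2) :=
      measurable_firstClockwise.comp measurable_prodMk_left
    rw [← lintegral_map (f := f) (g := fun z : ℝ × ℝ => firstClockwise p z.1 z.2) hf hmp,
      map_firstClockwise, lintegral_map hf (by fun_prop)]

/-! ### The Bernoulli density of the walk. -/

theorem continuous_normBernoulli (n : ℕ) : Continuous (normBernoulli n) :=
  (continuous_bernoulliFun n).div_const _

theorem hasDerivAt_normBernoulli (n : ℕ) (x : ℝ) :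
    HasDerivAt (normBernoulli (n + 1)) (normBernoulli n x) x := by
  have h := (hasDerivAt_bernoulliFun (n + 1) x).div_const ((n + 1)! : ℝ)
  have hn : ((n : ℝ) + 1) ≠ 0 := by positivity
  have hf : ((n)! : ℝ) ≠ 0 := by positivity
  refine HasDerivAt.congr_deriv h ?_
  simp only [normBernoulli, Nat.add_sub_cancel, Nat.factorial_succ, Nat.cast_mul]
  push_cast
  field_simp

theorem normBernoulli_one_eq_zero {n : ℕ} (hn : n ≠ 1) :
    normBernoulli n 1 = normBernoulli n 0 := by
  rw [normBernoulli, normBernoulli, bernoulliFun_endpoints_eq_of_ne_one hn]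

/-- The density `1 - 2 ^ n b_n` of the fractional part of a sum of `n` independent
beta(1,2) variables. -/
noncomputable def clockDensity (n : ℕ) (u : ℝ) : ℝ := 1 - 2 ^ n * normBernoulli n u

theorem continuous_clockDensity (n : ℕ) : Continuous (clockDensity n) :=
  continuous_const.sub (continuous_const.mul (continuous_normBernoulli n))

theorem clockDensity_one (u : ℝ) : clockDensity 1 u = 2 * (1 - u) := by
  simp [clockDensity, normBernoulli]; ring

/-- Integration by parts with an explicit primitive. The shift `c` serves both branches of the
convolution kernel: `1 - w` for `p ≤ w` and `-w` for `p > w`. -/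
theorem integral_clockDensity_mul_add (n : ℕ) (c a b : ℝ) :
    ∫ p in a..b, clockDensity n p * (2 * (p + c)) =
      ((b + c) ^ 2 - 2 ^ (n + 1) *
        (normBernoulli (n + 1) b * (b + c) - normBernoulli (n + 2) b)) -
      ((a + c) ^ 2 - 2 ^ (n + 1) *
        (normBernoulli (n + 1) a * (a + c) - normBernoulli (n + 2) a)) := by
  refine intervalIntegral.integral_eq_sub_of_hasDerivAt (f := fun p => (p + c) ^ 2 - 2 ^ (n + 1) *
      (normBernoulli (n + 1) p * (p + c) - normBernoulli (n + 2) p)) (fun p _ => ?_) ?_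
  · have hl : HasDerivAt (fun p : ℝ => p + c) 1 p := (hasDerivAt_id p).add_const c
    have h := (hl.pow 2).sub ((((hasDerivAt_normBernoulli n p).mul hl).sub
      (hasDerivAt_normBernoulli (n + 1) p)).const_mul (2 ^ (n + 1) : ℝ))
    refine HasDerivAt.congr_deriv h ?_
    simp only [clockDensity]
    ring
  · exact ((continuous_clockDensity n).mul (by fun_prop)).intervalIntegrable _ _

theorem fract_sub_of_le {w p : ℝ} (hp : 0 ≤ p) (hw : w < 1) (h : p ≤ w) :
    Int.fract (w - p) = w - p :=
  Int.fract_eq_self.2 ⟨by linarith, by linarith⟩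

theorem fract_sub_of_lt {w p : ℝ} (hw : 0 ≤ w) (hp : p < 1) (h : w < p) :
    Int.fract (w - p) = w - p + 1 := by
  rw [← Int.fract_add_one, Int.fract_eq_self.2 ⟨by linarith, by linarith⟩]

theorem integrable_clockDensity_convolution (n : ℕ) (w : ℝ) :
    Integrable (fun p => clockDensity n p * (2 * (1 - Int.fract (w - p)))) unitMeasure := by
  have hc : IntegrableOn (clockDensity n) (Set.Ico 0 1) volume :=
    ((continuous_clockDensity n).integrableOn_Icc).mono_set Set.Ico_subset_Icc_self
  refine Integrable.mul_bdd (c := 2) hc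
    (by fun_prop : Measurable fun p : ℝ => 2 * (1 - Int.fract (w - p))).aestronglyMeasurable
    (ae_of_all _ fun p => ?_)
  have h0 := Int.fract_nonneg (w - p)
  have h1 := Int.fract_lt_one (w - p)
  rw [Real.norm_eq_abs, abs_le]
  constructor <;> linarith

/-- The kernel is the density at `w` of a move starting from `p`. The terms at 0 and 1 cancel by
periodicity of the endpoint values of `b_{n+1}` and `b_{n+2}`, which needs `n + 1 ≠ 1`; what
survives comes from the jump of the kernel at `p = w`. -/
theorem integral_clockDensity_convolution {n : ℕ} (hn : 1 ≤ n) {w : ℝ}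
    (hw : w ∈ Set.Ico (0 : ℝ) 1) :
    ∫ p, clockDensity n p * (2 * (1 - Int.fract (w - p))) ∂unitMeasure =
      clockDensity (n + 1) w := by
  have hint := integrable_clockDensity_convolution n w
  rw [unitMeasure, restrict_Ico_eq_restrict_Ioc] at hint ⊢
  have hii : IntervalIntegrable (fun p => clockDensity n p * (2 * (1 - Int.fract (w - p))))
      volume 0 1 := (intervalIntegrable_iff_integrableOn_Ioc_of_le zero_le_one).2 hint
  rw [← intervalIntegral.integral_of_le zero_le_one,
    ← intervalIntegral.integral_add_adjacent_intervals (b := w)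
      (hii.mono_set (by
        rw [Set.uIcc_of_le hw.1, Set.uIcc_of_le zero_le_one]
        exact Set.Icc_subset_Icc le_rfl hw.2.le))
      (hii.mono_set (by
        rw [Set.uIcc_of_le hw.2.le, Set.uIcc_of_le zero_le_one]
        exact Set.Icc_subset_Icc hw.1 le_rfl))]
  have h1 : ∫ p in (0 : ℝ)..w, clockDensity n p * (2 * (1 - Int.fract (w - p))) =
      ∫ p in (0 : ℝ)..w, clockDensity n p * (2 * (p + (1 - w))) := by
    refine intervalIntegral.integral_congr fun p hp => ?_
    rw [Set.uIcc_of_le hw.1] at hp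
    simp only [fract_sub_of_le hp.1 hw.2 hp.2]
    ring
  have h2 : ∫ p in w..(1 : ℝ), clockDensity n p * (2 * (1 - Int.fract (w - p))) =
      ∫ p in w..(1 : ℝ), clockDensity n p * (2 * (p + -w)) := by
    rw [intervalIntegral.integral_of_le hw.2.le, intervalIntegral.integral_of_le hw.2.le,
      integral_Ioc_eq_integral_Ioo, integral_Ioc_eq_integral_Ioo]
    refine setIntegral_congr_fun measurableSet_Ioo fun p hp => ?_
    simp only [fract_sub_of_lt hw.1 hp.2 hp.1]
    ring
  rw [h1, h2, integral_clockDensity_mul_add, integral_clockDensity_mul_add,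
    normBernoulli_one_eq_zero (n := n + 1) (by omega),
    normBernoulli_one_eq_zero (n := n + 2) (by omega), clockDensity]
  ring

/-- Convolution with a nonnegative kernel preserves nonnegativity. This ensures that
`ENNReal.ofReal` truncates nothing in the density statements. -/
theorem clockDensity_nonneg {n : ℕ} (hn : 1 ≤ n) : ∀ u ∈ Set.Ico (0 : ℝ) 1,
    0 ≤ clockDensity n u := by
  induction n, hn using Nat.le_induction with
  | base => intro u hu; rw [clockDensity_one]; linarith [hu.2]
  | succ n hn ih =>
    intro u hu
    rw [← integral_clockDensity_convolution hn hu]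
    refine integral_nonneg_of_ae ?_
    filter_upwards [ae_unitMeasure_mem] with p hp
    have := Int.fract_lt_one (u - p)
    exact mul_nonneg (ih p hp) (by linarith)

/-- The induction starts at 1 because `clockLaw 0` is a point mass. In the inductive step,
substitution by rotation and Tonelli expose the convolution integral. -/
theorem clockLaw_eq_withDensity {n : ℕ} (hn : 1 ≤ n) :
    clockLaw n = unitMeasure.withDensity (fun u => ENNReal.ofReal (clockDensity n u)) := by
  have hmeas (n : ℕ) : Measurable fun u => ENNReal.ofReal (clockDensity n u) :=
    (continuous_clockDensity n).measurable.ennreal_ofReal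
  induction n, hn using Nat.le_induction with
  | base =>
    refine Measure.ext_of_lintegral _ fun f hf => ?_
    rw [lintegral_clockLaw_succ 0 hf, lintegral_withDensity_eq_lintegral_mul _ (hmeas 1) hf,
      clockLaw, lintegral_dirac' _ ?_, lintegral_betaMeasure_one_two (by fun_prop)]
    · refine lintegral_congr_ae ?_
      filter_upwards [ae_unitMeasure_mem] with x hx
      rw [zero_add, Int.fract_eq_self.2 hx, Pi.mul_apply, clockDensity_one]
    · exact (hf.comp (by fun_prop : Measurable fun z : ℝ × ℝ =>
        Int.fract (z.1 + z.2))).lintegral_prod_right'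
  | succ n hn ih =>
    refine Measure.ext_of_lintegral _ fun f hf => ?_
    have hfp : Measurable fun p => ∫⁻ x, f (Int.fract (p + x)) ∂betaMeasure 1 2 :=
      (hf.comp (by fun_prop : Measurable fun z : ℝ × ℝ =>
        Int.fract (z.1 + z.2))).lintegral_prod_right'
    rw [lintegral_clockLaw_succ n hf, ih,
      lintegral_withDensity_eq_lintegral_mul _ (hmeas n) hfp,
      lintegral_withDensity_eq_lintegral_mul _ (hmeas (n + 1)) hf]
    have hinner (p : ℝ) : ∫⁻ x, f (Int.fract (p + x)) ∂betaMeasure 1 2 =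
        ∫⁻ w, ENNReal.ofReal (2 * (1 - Int.fract (w - p))) * f w ∂unitMeasure := by
      rw [lintegral_betaMeasure_one_two (by fun_prop),
        ← (measurePreserving_fract_add p).lintegral_comp
          (f := fun w => ENNReal.ofReal (2 * (1 - Int.fract (w - p))) * f w) (by fun_prop)]
      refine lintegral_congr_ae ?_
      filter_upwards [ae_unitMeasure_mem] with x hx
      rw [fract_fract_add_sub_cancel hx]
    have hcm : Measurable fun z : ℝ × ℝ => ENNReal.ofReal (clockDensity n z.1) *
        (ENNReal.ofReal (2 * (1 - Int.fract (z.2 - z.1))) * f z.2) :=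
      ((hmeas n).comp measurable_fst).mul (by fun_prop)
    calc ∫⁻ p, ((fun u => ENNReal.ofReal (clockDensity n u)) *
          fun p => ∫⁻ x, f (Int.fract (p + x)) ∂betaMeasure 1 2) p ∂unitMeasure
        = ∫⁻ p, ∫⁻ w, ENNReal.ofReal (clockDensity n p) *
            (ENNReal.ofReal (2 * (1 - Int.fract (w - p))) * f w) ∂unitMeasure ∂unitMeasure := by
          refine lintegral_congr fun p => ?_
          rw [Pi.mul_apply, hinner, lintegral_const_mul _ (by fun_prop)]
      _ = ∫⁻ w, ∫⁻ p, ENNReal.ofReal (clockDensity n p) *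
            (ENNReal.ofReal (2 * (1 - Int.fract (w - p))) * f w) ∂unitMeasure ∂unitMeasure :=
          lintegral_lintegral_swap hcm.aemeasurable
      _ = _ := by
          refine lintegral_congr_ae ?_
          filter_upwards [ae_unitMeasure_mem] with w hw
          rw [Pi.mul_apply, ← integral_clockDensity_convolution hn hw,
            ofReal_integral_eq_lintegral_ofReal (integrable_clockDensity_convolution n w)]
          · rw [← lintegral_mul_const]
            · refine lintegral_congr_ae ?_
              filter_upwards [ae_unitMeasure_mem] with p hp
              rw [ENNReal.ofReal_mul (clockDensity_nonneg hn p hp), mul_assoc]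
            · exact ((continuous_clockDensity n).measurable.mul (by fun_prop)).ennreal_ofReal
          · filter_upwards [ae_unitMeasure_mem] with p hp
            have := Int.fract_lt_one (w - p)
            exact mul_nonneg (clockDensity_nonneg hn p hp) (by linarith)

/-! ### The index depends only on the relative order of the points. -/

theorem fract_sub_eq_ite {p a : ℝ} (hp : p ∈ Set.Ico (0 : ℝ) 1) (ha : a ∈ Set.Ico (0 : ℝ) 1) :
    Int.fract (a - p) = if p ≤ a then a - p else a - p + 1 := by
  split_ifs with h
  · exact fract_sub_of_le hp.1 ha.2 h
  · exact fract_sub_of_lt ha.1 hp.2 (not_le.1 h)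

/-- Clockwise from `p`, points at or above `p` precede those below it, and within each group the
usual order holds. -/
theorem fract_sub_le_fract_sub_iff {p a b p' a' b' : ℝ}
    (hp : p ∈ Set.Ico (0 : ℝ) 1) (ha : a ∈ Set.Ico (0 : ℝ) 1) (hb : b ∈ Set.Ico (0 : ℝ) 1)
    (hp' : p' ∈ Set.Ico (0 : ℝ) 1) (ha' : a' ∈ Set.Ico (0 : ℝ) 1) (hb' : b' ∈ Set.Ico (0 : ℝ) 1)
    (hpa : p ≤ a ↔ p' ≤ a') (hpb : p ≤ b ↔ p' ≤ b') (hab : a ≤ b ↔ a' ≤ b') :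
    Int.fract (a - p) ≤ Int.fract (b - p) ↔ Int.fract (a' - p') ≤ Int.fract (b' - p') := by
  rw [fract_sub_eq_ite hp ha, fract_sub_eq_ite hp hb, fract_sub_eq_ite hp' ha',
    fract_sub_eq_ite hp' hb']
  simp only [← hpa, ← hpb]
  obtain ⟨ha0, ha1⟩ := ha
  obtain ⟨hb0, hb1⟩ := hb
  obtain ⟨ha0', ha1'⟩ := ha'
  obtain ⟨hb0', hb1'⟩ := hb'
  split_ifs with h1 h2 h2
  · simpa using hab
  · exact ⟨fun _ => by linarith, fun _ => by linarith⟩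
  · exact ⟨fun _ => by linarith, fun _ => by linarith⟩
  · simpa using hab

/-- The labelling `e` lets the induction drop the last pair while the order hypothesis stays on all
of `ι`. The case `n = 0` is apart because the origin is not one of the points; it lies below all of
them in both configurations, so the first move is covered too. -/
theorem clockStop_sameOrder {ι : Type*} {u v : ι → ℝ} (hu : ∀ i, u i ∈ Set.Ico (0 : ℝ) 1)
    (hv : ∀ i, v i ∈ Set.Ico (0 : ℝ) 1) (h : ∀ i j, u i ≤ u j ↔ v i ≤ v j) :
    ∀ (n : ℕ) (e : Fin n × Fin 2 → ι), n = 0 ∨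
      ∃ l, clockStop n (fun i => u (e i)) = u (e l) ∧ clockStop n (fun i => v (e i)) = v (e l)
  | 0, _ => Or.inl rfl
  | n + 1, e => by
    right
    let c : Fin n × Fin 2 → ι := fun ij => e (ij.1.castSucc, ij.2)
    have key : ∀ p q : ℝ, p ∈ Set.Ico (0 : ℝ) 1 → q ∈ Set.Ico (0 : ℝ) 1 →
        (∀ i, p ≤ u i ↔ q ≤ v i) → ∃ l,
          firstClockwise p (u (e (Fin.last n, 0))) (u (e (Fin.last n, 1))) = u (e l) ∧
          firstClockwise q (v (e (Fin.last n, 0))) (v (e (Fin.last n, 1))) = v (e l) := by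
      intro p q hp hq hpq
      have := fract_sub_le_fract_sub_iff hp (hu (e (Fin.last n, 0))) (hu (e (Fin.last n, 1)))
        hq (hv (e (Fin.last n, 0))) (hv (e (Fin.last n, 1))) (hpq _) (hpq _) (h _ _)
      unfold firstClockwise
      simp only [← this]
      split_ifs
      · exact ⟨_, rfl, rfl⟩
      · exact ⟨_, rfl, rfl⟩
    rcases clockStop_sameOrder hu hv h n c with rfl | ⟨l, hl1, hl2⟩
    · exact key 0 0 (by simp) (by simp) fun i => by simp [(hu i).1, (hv i).1]
    · refine key _ _ ?_ ?_ ?_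
      · rw [hl1]; exact hu _
      · rw [hl2]; exact hv _
      · intro i
        rw [hl1, hl2]
        exact h _ _

theorem exists_clockStop_eq : ∀ {n : ℕ} (_ : 1 ≤ n) (u : Fin n × Fin 2 → ℝ),
    ∃ l, clockStop n u = u l
  | n + 1, _, u => by
    simp only [clockStop, firstClockwise]
    split_ifs
    · exact ⟨_, rfl⟩
    · exact ⟨_, rfl⟩

theorem clockIndex_mem_Icc {n : ℕ} (hn : 1 ≤ n) (u : Fin n × Fin 2 → ℝ) :
    clockIndex n u ∈ Finset.Icc 1 (2 * n) := by
  obtain ⟨l, hl⟩ := exists_clockStop_eq hn u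
  rw [Finset.mem_Icc, clockIndex]
  constructor
  · exact Finset.card_pos.2 ⟨l, by simp [hl]⟩
  · refine (Finset.card_le_univ _).trans_eq ?_
    simp [mul_comm]

theorem clockIndex_eq_of_sameOrder {n : ℕ} (hn : 1 ≤ n) {u v : Fin n × Fin 2 → ℝ}
    (hu : ∀ i, u i ∈ Set.Ico (0 : ℝ) 1) (hv : ∀ i, v i ∈ Set.Ico (0 : ℝ) 1)
    (h : ∀ i j, u i ≤ u j ↔ v i ≤ v j) : clockIndex n u = clockIndex n v := by
  rcases clockStop_sameOrder hu hv h n id with rfl | ⟨l, hl1, hl2⟩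
  · omega
  · simp only [id] at hl1 hl2
    simp only [clockIndex, hl1, hl2, h]

/-! ### Ranks, order statistics and permutations of the points. -/

section Rank

variable {ι : Type*} [Fintype ι]

/-- The rank of `u i` among the values of `u`. -/
noncomputable def rankOf (u : ι → ℝ) (i : ι) : ℕ :=
  (Finset.univ.filter (fun j => u j ≤ u i)).card

theorem rankOf_injective {u : ι → ℝ} (hu : Function.Injective u) :
    Function.Injective (rankOf u) := by
  have hlt : ∀ i j, u i < u j → rankOf u i < rankOf u j := by
    intro i j hij
    refine Finset.card_lt_card ⟨fun l hl => ?_, fun hsub => ?_⟩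
    · simp only [Finset.mem_filter, Finset.mem_univ, true_and] at hl ⊢
      exact hl.trans hij.le
    · have := @hsub j (by simp)
      simp only [Finset.mem_filter, Finset.mem_univ, true_and] at this
      exact absurd this (not_le.2 hij)
  intro i j hij
  rcases lt_trichotomy (u i) (u j) with h | h | h
  · exact absurd hij (hlt _ _ h).ne
  · exact hu h
  · exact absurd hij (hlt _ _ h).ne'

theorem exists_equiv_fin_monotone {u : ι → ℝ} (hu : Function.Injective u) :
    ∃ e : Fin (Fintype.card ι) ≃ ι, ∀ a b, u (e a) ≤ u (e b) ↔ a ≤ b := by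
  let _ : LinearOrder ι := LinearOrder.lift' u hu
  let e := Fintype.orderIsoFinOfCardEq ι rfl
  exact ⟨e.toEquiv, fun a b => e.le_iff_le⟩

theorem exists_perm_sameOrder {u v : ι → ℝ} (hu : Function.Injective u)
    (hv : Function.Injective v) :
    ∃ τ : Equiv.Perm ι, ∀ i j, u i ≤ u j ↔ v (τ i) ≤ v (τ j) := by
  obtain ⟨e, he⟩ := exists_equiv_fin_monotone hu
  obtain ⟨e', he'⟩ := exists_equiv_fin_monotone hv
  refine ⟨e.symm.trans e', fun i j => ?_⟩
  simp only [Equiv.trans_apply, he']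
  rw [← he]
  simp

theorem rankOf_comp_perm (u : ι → ℝ) (σ : Equiv.Perm ι) (i : ι) :
    rankOf (fun j => u (σ j)) i = rankOf u (σ i) :=
  Finset.card_equiv σ (by simp)

theorem rankOf_eq_card_add_one [DecidableEq ι] (u : ι → ℝ) (i : ι) :
    rankOf u i =
      (Finset.univ.filter (fun j : {j // ¬ j = i} => u j ≤ u i)).card + 1 := by
  have : Finset.univ.filter (fun j => u j ≤ u i) = insert i
      ((Finset.univ.filter (fun j : {j // ¬ j = i} => u j ≤ u i)).map
        (Function.Embedding.subtype _)) := by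
    ext j
    by_cases hj : j = i <;> simp [hj]
  rw [rankOf, this, Finset.card_insert_of_notMem (by simp), Finset.card_map]

/-- The function `f`, evaluated at the value of rank `k` of `u`. -/
noncomputable def atRank (f : ℝ → ENNReal) (k : ℕ) (u : ι → ℝ) : ENNReal :=
  ∑ i, if rankOf u i = k then f (u i) else 0

theorem atRank_rankOf (f : ℝ → ENNReal) {u : ι → ℝ} (hu : Function.Injective u) (i : ι) :
    atRank f (rankOf u i) u = f (u i) := by
  rw [atRank, Finset.sum_eq_single i]
  · simp
  · intro j _ hj
    rw [if_neg fun h => hj (rankOf_injective hu h)]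
  · simp

end Rank

/-- Permuting the labels leaves the sorted values unchanged, so `σ` enters the right side only
through the index. -/
theorem clockStop_perm {n : ℕ} (hn : 1 ≤ n) (f : ℝ → ENNReal) {u : Fin n × Fin 2 → ℝ}
    (hu : Function.Injective u) (σ : Equiv.Perm (Fin n × Fin 2)) :
    f (clockStop n (fun i => u (σ i))) = atRank f (clockIndex n (fun i => u (σ i))) u := by
  obtain ⟨l, hl⟩ := exists_clockStop_eq hn (fun i => u (σ i))
  have : clockIndex n (fun i => u (σ i)) = rankOf (fun i => u (σ i)) l := by
    rw [clockIndex, hl, rankOf]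
  rw [this, rankOf_comp_perm, atRank_rankOf f hu, hl]

/-- A permutation `τ` matching the orders of `u` and `v` carries one set of permutations onto the
other by left multiplication. This is the combinatorial form of the independence of index and sorted
values. -/
theorem card_perm_clockIndex_eq {n : ℕ} (hn : 1 ≤ n) {u v : Fin n × Fin 2 → ℝ}
    (hu : Function.Injective u) (hv : Function.Injective v)
    (hu1 : ∀ i, u i ∈ Set.Ico (0 : ℝ) 1) (hv1 : ∀ i, v i ∈ Set.Ico (0 : ℝ) 1) (k : ℕ) :
    (Finset.univ.filter (fun σ : Equiv.Perm (Fin n × Fin 2) =>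
      clockIndex n (fun i => u (σ i)) = k)).card =
    (Finset.univ.filter (fun σ : Equiv.Perm (Fin n × Fin 2) =>
      clockIndex n (fun i => v (σ i)) = k)).card := by
  obtain ⟨τ, hτ⟩ := exists_perm_sameOrder hu hv
  refine Finset.card_equiv (Equiv.mulLeft τ) fun σ => ?_
  simp only [Finset.mem_filter, Finset.mem_univ, true_and, Equiv.coe_mulLeft,
    Equiv.Perm.coe_mul, Function.comp]
  rw [clockIndex_eq_of_sameOrder hn (fun i => hu1 (σ i)) (fun i => hv1 (τ (σ i)))
    (fun i j => hτ (σ i) (σ j))]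

theorem sum_perm_clockStop {n : ℕ} (hn : 1 ≤ n) (f : ℝ → ENNReal) {u : Fin n × Fin 2 → ℝ}
    (hu : Function.Injective u) :
    ∑ σ : Equiv.Perm (Fin n × Fin 2), f (clockStop n (fun i => u (σ i))) =
      ∑ k ∈ Finset.Icc 1 (2 * n), ((Finset.univ.filter
        (fun σ : Equiv.Perm (Fin n × Fin 2) => clockIndex n (fun i => u (σ i)) = k)).card : ENNReal) *
          atRank f k u := by
  rw [← Finset.sum_fiberwise_of_maps_to
    (fun (σ : Equiv.Perm (Fin n × Fin 2)) _ => clockIndex_mem_Icc hn (fun i => u (σ i)))]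
  refine Finset.sum_congr rfl fun k _ => ?_
  rw [← nsmul_eq_mul]
  refine Finset.sum_eq_card_nsmul fun σ hσ => ?_
  rw [clockStop_perm hn f hu, (Finset.mem_filter.1 hσ).2]

/-! ### Order statistics of independent uniform points. -/

section Pi

variable {ι : Type*} [Fintype ι]

/-- The binomial law: partition the event by the set `A` of coordinates that fall in `S`. -/
theorem pi_card_mem_eq (ν : Measure ℝ) [IsProbabilityMeasure ν] {S : Set ℝ}
    [DecidablePred (· ∈ S)] (hS : MeasurableSet S) (m : ℕ) :
    Measure.pi (fun _ : ι => ν) {v | (Finset.univ.filter (fun j => v j ∈ S)).card = m} =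
      (Fintype.card ι).choose m * (ν S ^ m * ν Sᶜ ^ (Fintype.card ι - m)) := by
  classical
  have hset : {v : ι → ℝ | (Finset.univ.filter (fun j => v j ∈ S)).card = m} =
      ⋃ A ∈ Finset.powersetCard m (Finset.univ : Finset ι),
        Set.univ.pi (fun j => if j ∈ A then S else Sᶜ) := by
    ext v
    simp only [Set.mem_ofPred_eq, Set.mem_iUnion, Finset.mem_powersetCard, Finset.subset_univ,
      true_and, Set.mem_univ_pi, exists_prop]
    constructor
    · intro h
      refine ⟨_, h, fun j => ?_⟩
      by_cases hj : v j ∈ S <;> simp [hj]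
    · rintro ⟨A, hA, h⟩
      rw [← hA]
      congr 1
      ext j
      have := h j
      by_cases hj : j ∈ A <;> simp_all
  rw [hset, measure_biUnion_finset]
  · have hprod : ∀ A ∈ Finset.powersetCard m (Finset.univ : Finset ι),
        Measure.pi (fun _ : ι => ν) (Set.univ.pi (fun j => if j ∈ A then S else Sᶜ)) =
          ν S ^ m * ν Sᶜ ^ (Fintype.card ι - m) := by
      intro A hA
      rw [Measure.pi_pi]
      simp only [apply_ite ν]
      rw [Finset.prod_ite, Finset.prod_const, Finset.prod_const, Finset.filter_mem_eq_inter,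
        Finset.univ_inter, ← (Finset.mem_powersetCard.1 hA).2, Finset.filter_not,
        Finset.filter_mem_eq_inter, Finset.univ_inter, ← Finset.compl_eq_univ_sdiff,
        Finset.card_compl]
    rw [Finset.sum_congr rfl hprod, Finset.sum_const, Finset.card_powersetCard, nsmul_eq_mul,
      Finset.card_univ]
  · intro A _ B _ hAB
    rw [Function.onFun, Set.disjoint_left]
    intro v hA hB
    refine hAB ?_
    ext j
    have h1 := hA j (Set.mem_univ j)
    have h2 := hB j (Set.mem_univ j)
    by_cases h : v j ∈ S <;> by_cases hjA : j ∈ A <;> by_cases hjB : j ∈ B <;> simp_all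
  · intro A _
    refine MeasurableSet.univ_pi fun j => ?_
    split_ifs
    · exact hS
    · exact hS.compl

theorem measurable_card_filter {α κ : Type*} [MeasurableSpace α] [Fintype κ] {p : α → κ → Prop}
    [∀ a, DecidablePred (p a)] (hp : ∀ j, MeasurableSet {a | p a j}) :
    Measurable (fun a => (Finset.univ.filter (fun j => p a j)).card) := by
  simp only [Finset.card_filter]
  exact Finset.measurable_sum _ fun j _ => Measurable.ite (hp j) measurable_const measurable_const

theorem measurable_rankOf (i : ι) : Measurable (fun u : ι → ℝ => rankOf u i) :=
  measurable_card_filter fun j => measurableSet_le (measurable_pi_apply j) (measurable_pi_apply i)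

theorem measurable_ite_rankOf {f : ℝ → ENNReal} (hf : Measurable f) (k : ℕ) (i : ι) :
    Measurable (fun u : ι → ℝ => if rankOf u i = k then f (u i) else 0) :=
  Measurable.ite (measurable_rankOf i (measurableSet_singleton k))
    (hf.comp (measurable_pi_apply i)) measurable_const

/-- Condition on `u i = t`: the number of other points at most `t` is binomial with success
probability `t`. -/
theorem lintegral_ite_rankOf [DecidableEq ι] {f : ℝ → ENNReal} (hf : Measurable f) {k : ℕ}
    (hk : 1 ≤ k) (i : ι) :
    ∫⁻ u, (if rankOf u i = k then f (u i) else 0) ∂Measure.pi (fun _ : ι => unitMeasure) =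
      ∫⁻ t, f t * ENNReal.ofReal ((Fintype.card ι - 1).choose (k - 1) *
        (t ^ (k - 1) * (1 - t) ^ (Fintype.card ι - k))) ∂unitMeasure := by
  -- The rank of `u i` counts `u i` itself, so rank `k` means that `k - 1` of the other points lie
  -- at or below it; `1 ≤ k` keeps the subtraction honest.
  let G : ({j // j = i} → ℝ) × ({j // ¬ j = i} → ℝ) → ENNReal := fun z =>
    if (Finset.univ.filter (fun j => z.2 j ∈ Set.Iic (z.1 ⟨i, rfl⟩))).card = k - 1
      then f (z.1 ⟨i, rfl⟩) else 0
  have hG : Measurable G := by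
    refine Measurable.ite ?_ (hf.comp (by fun_prop)) measurable_const
    refine measurable_card_filter (fun j => ?_) (measurableSet_singleton (k - 1))
    exact measurableSet_le ((measurable_pi_apply j).comp measurable_snd)
      ((measurable_pi_apply _).comp measurable_fst)
  have h1 := (measurePreserving_piEquivPiSubtypeProd (fun _ : ι => unitMeasure)
    (fun j => j = i)).lintegral_comp hG
  have h2 : ∀ u : ι → ℝ, (if rankOf u i = k then f (u i) else 0) =
      G (MeasurableEquiv.piEquivPiSubtypeProd (fun _ => ℝ) (fun j => j = i) u) := by
    intro u
    simp only [G, MeasurableEquiv.piEquivPiSubtypeProd, MeasurableEquiv.coe_mk,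
      Equiv.piEquivPiSubtypeProd, Equiv.coe_fn_mk, rankOf_eq_card_add_one, Set.mem_Iic]
    congr 1
    exact propext (by omega)
  simp_rw [h2]
  rw [h1, lintegral_prod _ hG.aemeasurable]
  have hcard : Fintype.card {j // ¬ j = i} = Fintype.card ι - 1 := by
    rw [Fintype.card_subtype_compl, Fintype.card_subtype_eq]
  have h3 : ∀ a : {j // j = i} → ℝ,
      ∫⁻ v, G (a, v) ∂Measure.pi (fun _ : {j // ¬ j = i} => unitMeasure) =
      (fun t => f t * ((Fintype.card ι - 1).choose (k - 1) * (unitMeasure (Set.Iic t) ^ (k - 1) *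
        unitMeasure (Set.Iic t)ᶜ ^ (Fintype.card ι - 1 - (k - 1))))) (a ⟨i, rfl⟩) := by
    intro a
    have := pi_card_mem_eq (ι := {j // ¬ j = i}) unitMeasure
      (measurableSet_Iic (a := a ⟨i, rfl⟩)) (k - 1)
    rw [hcard] at this
    simp only
    rw [← this, ← lintegral_indicator_const]
    · refine lintegral_congr fun v => ?_
      simp only [G, Set.indicator, Set.mem_ofPred_eq]
    · refine measurable_card_filter (fun j => ?_) (measurableSet_singleton (k - 1))
      exact measurableSet_le (measurable_pi_apply j) measurable_const
  simp_rw [h3]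
  have hIic : Measurable fun t => unitMeasure (Set.Iic t) :=
    Monotone.measurable fun a b h => measure_mono (Set.Iic_subset_Iic.2 h)
  have hIoi : Measurable fun t => unitMeasure (Set.Iic t)ᶜ :=
    Antitone.measurable fun a b h => measure_mono
      (Set.compl_subset_compl.2 (Set.Iic_subset_Iic.2 h))
  let _ : Fintype {j // j = i} := Subtype.fintype fun j => j = i
  refine ((measurePreserving_eval (fun _ : {j // j = i} => unitMeasure) ⟨i, rfl⟩).lintegral_comp
    (f := fun t => f t * ((Fintype.card ι - 1).choose (k - 1) * (unitMeasure (Set.Iic t) ^ (k - 1) *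
        unitMeasure (Set.Iic t)ᶜ ^ (Fintype.card ι - 1 - (k - 1))))) (by fun_prop)).trans
          (lintegral_congr_ae ?_)
  filter_upwards [ae_unitMeasure_mem] with t ht
  have hI : unitMeasure (Set.Iic t) = ENNReal.ofReal t := by
    rw [unitMeasure, Measure.restrict_apply measurableSet_Iic]
    have : Set.Iic t ∩ Set.Ico 0 1 = Set.Icc 0 t := by
      ext y; simp only [Set.mem_inter_iff, Set.mem_Iic, Set.mem_Ico, Set.mem_Icc]
      exact ⟨fun h => ⟨h.2.1, h.1⟩, fun h => ⟨h.2, h.1, h.2.trans_lt ht.2⟩⟩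
    rw [this, Real.volume_Icc, sub_zero]
  have hI' : unitMeasure (Set.Iic t)ᶜ = ENNReal.ofReal (1 - t) := by
    rw [prob_compl_eq_one_sub measurableSet_Iic, hI, ENNReal.ofReal_sub _ ht.1, ENNReal.ofReal_one]
  have h1t : 0 ≤ 1 - t := by linarith [ht.2]
  rw [hI, hI', ENNReal.ofReal_mul (by positivity), ENNReal.ofReal_mul (pow_nonneg ht.1 _),
    ENNReal.ofReal_pow ht.1, ENNReal.ofReal_pow h1t, ENNReal.ofReal_natCast,
    show Fintype.card ι - 1 - (k - 1) = Fintype.card ι - k by omega]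

theorem card_mul_choose_eq_normBernstein {N k : ℕ} (hk : 1 ≤ k) (hkN : k ≤ N) (t : ℝ) :
    N * ((N - 1).choose (k - 1) * (t ^ (k - 1) * (1 - t) ^ (N - k))) = normBernstein k N t := by
  have h := Nat.choose_mul_factorial_mul_factorial (show k - 1 ≤ N - 1 by omega)
  rw [show N - 1 - (k - 1) = N - k by omega] at h
  have h' : ((N - 1).choose (k - 1) : ℝ) * (k - 1)! * (N - k)! = (N - 1)! := by exact_mod_cast h
  have hN : (N ! : ℝ) = N * (N - 1)! := by
    exact_mod_cast (Nat.mul_factorial_pred (show N ≠ 0 by omega)).symm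
  have h1 : ((k - 1)! : ℝ) ≠ 0 := by positivity
  have h2 : ((N - k)! : ℝ) ≠ 0 := by positivity
  rw [normBernstein, hN, ← h']
  field_simp

theorem lintegral_atRank [DecidableEq ι] {f : ℝ → ENNReal} (hf : Measurable f) {k : ℕ}
    (hk : 1 ≤ k) (hkN : k ≤ Fintype.card ι) :
    ∫⁻ u, atRank f k u ∂Measure.pi (fun _ : ι => unitMeasure) =
      ∫⁻ t, f t * ENNReal.ofReal (normBernstein k (Fintype.card ι) t) ∂unitMeasure := by
  simp only [atRank]
  rw [lintegral_finsetSum _ fun i _ => measurable_ite_rankOf hf k i]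
  simp_rw [lintegral_ite_rankOf hf hk]
  rw [Finset.sum_const, Finset.card_univ, nsmul_eq_mul, ← lintegral_const_mul _ (by fun_prop)]
  refine lintegral_congr fun t => ?_
  rw [← card_mul_choose_eq_normBernstein hk hkN,
    ENNReal.ofReal_mul (p := (Fintype.card ι : ℝ)) (Nat.cast_nonneg _),
    ENNReal.ofReal_natCast]
  ring

theorem ae_pi_unitMeasure_mem :
    ∀ᵐ u ∂Measure.pi (fun _ : ι => unitMeasure), ∀ i, u i ∈ Set.Ico (0 : ℝ) 1 :=
  ae_all_iff.2 fun i => (measurePreserving_eval (fun _ : ι => unitMeasure) i).quasiMeasurePreserving.ae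
    ae_unitMeasure_mem

theorem ae_prod_unitMeasure_ne : ∀ᵐ z ∂unitMeasure.prod unitMeasure, z.1 ≠ z.2 := by
  have hm : MeasurableSet {z : ℝ × ℝ | z.1 ≠ z.2} :=
    (measurableSet_eq_fun measurable_fst measurable_snd).compl
  refine (Measure.ae_prod_iff_ae_ae hm).2 (ae_of_all _ fun x => ?_)
  simp [ae_iff]

theorem ae_pi_unitMeasure_injective :
    ∀ᵐ u ∂Measure.pi (fun _ : ι => unitMeasure), Function.Injective u := by
  have hind : iIndepFun (fun (i : ι) (u : ι → ℝ) => u i) (Measure.pi fun _ : ι => unitMeasure) :=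
    iIndepFun_pi (X := fun _ => id) fun _ => aemeasurable_id
  have h : ∀ i j, ∀ᵐ u ∂Measure.pi (fun _ : ι => unitMeasure), u i = u j → i = j := by
    intro i j
    by_cases hij : i = j
    · simp [hij]
    · have hp := (indepFun_iff_map_prod_eq_prod_map_map (measurable_pi_apply i).aemeasurable
        (measurable_pi_apply j).aemeasurable).1 (hind.indepFun hij)
      have hev (l : ι) := (measurePreserving_eval (fun _ : ι => unitMeasure) l).map_eq
      have hev' (l : ι) : Measure.map (fun u : ι → ℝ => u l)
        (Measure.pi fun _ : ι => unitMeasure) = unitMeasure := hev l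
      rw [hev', hev'] at hp
      have := ae_prod_unitMeasure_ne
      rw [← hp] at this
      filter_upwards [ae_of_ae_map (by fun_prop) this] with u hu h
      exact absurd h hu
  filter_upwards [ae_all_iff.2 fun i => ae_all_iff.2 (h i)] with u hu i j
  exact hu i j

theorem measurePreserving_comp_perm (σ : Equiv.Perm ι) :
    MeasurePreserving (fun (u : ι → ℝ) i => u (σ i)) (Measure.pi fun _ : ι => unitMeasure)
      (Measure.pi fun _ : ι => unitMeasure) := by
  have := measurePreserving_piCongrLeft (fun _ : ι => unitMeasure) σ.symm
  convert this using 1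
  ext u i
  simp [MeasurableEquiv.coe_piCongrLeft, Equiv.piCongrLeft_apply]

end Pi

/-! ### Averaging over permutations. -/

theorem measurable_clockIndex (n : ℕ) : Measurable (clockIndex n) :=
  measurable_card_filter fun i => measurableSet_le (measurable_pi_apply i) (measurable_clockStop n)

theorem factorial_mul_lintegral_eq_lintegral_sum_perm {ι : Type*} [Fintype ι] [DecidableEq ι]
    {F : (ι → ℝ) → ENNReal} (hF : Measurable F) :
    ((Fintype.card ι)! : ENNReal) * ∫⁻ u, F u ∂Measure.pi (fun _ : ι => unitMeasure) =
      ∫⁻ u, ∑ σ : Equiv.Perm ι, F (fun i => u (σ i)) ∂Measure.pi (fun _ : ι => unitMeasure) := by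
  have hFσ (σ : Equiv.Perm ι) : Measurable fun u : ι → ℝ => F (fun i => u (σ i)) :=
    hF.comp (measurePreserving_comp_perm σ).measurable
  rw [lintegral_finsetSum _ fun σ _ => hFσ σ]
  simp_rw [(measurePreserving_comp_perm _).lintegral_comp hF]
  rw [Finset.sum_const, Finset.card_univ, Fintype.card_perm, nsmul_eq_mul]

/-- After symmetrization the integrand is a sum over `k` of a permutation count times the value at
rank `k`. The counts are almost surely constant, so they leave the integral. -/
theorem lintegral_clockStop {n : ℕ} (hn : 1 ≤ n) {f : ℝ → ENNReal} (hf : Measurable f) :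
    ∫⁻ u, f (clockStop n u) ∂Measure.pi (fun _ : Fin n × Fin 2 => unitMeasure) =
      ∑ k ∈ Finset.Icc 1 (2 * n),
        Measure.pi (fun _ : Fin n × Fin 2 => unitMeasure) {u | clockIndex n u = k} *
          ∫⁻ t, f t * ENNReal.ofReal (normBernstein k (2 * n) t) ∂unitMeasure := by
  let μ := Measure.pi (fun _ : Fin n × Fin 2 => unitMeasure)
  have hcard : Fintype.card (Fin n × Fin 2) = 2 * n := by simp [mul_comm]
  -- A fixed reference configuration: its permutation counts `c k` equal those of almost every `u`.
  obtain ⟨w, hw, hw1⟩ := (ae_pi_unitMeasure_injective.and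
    (ae_pi_unitMeasure_mem (ι := Fin n × Fin 2))).exists
  let c : ℕ → ENNReal := fun k => ((Finset.univ.filter
    (fun σ : Equiv.Perm (Fin n × Fin 2) => clockIndex n (fun i => w (σ i)) = k)).card : ENNReal)
  have hfac0 : ((2 * n)! : ENNReal) ≠ 0 := by exact_mod_cast (2 * n).factorial_ne_zero
  have hfact : ((2 * n)! : ENNReal) ≠ ⊤ := ENNReal.natCast_ne_top _
  -- The same symmetrization, applied to the indicator of the event, identifies the counts with
  -- probabilities.
  have hc : ∀ k, c k = (2 * n)! * μ {u | clockIndex n u = k} := by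
    intro k
    have hms : MeasurableSet {u : Fin n × Fin 2 → ℝ | clockIndex n u = k} :=
      measurable_clockIndex n (measurableSet_singleton k)
    rw [← lintegral_indicator_one hms, ← hcard,
      factorial_mul_lintegral_eq_lintegral_sum_perm (measurable_one.indicator hms)]
    symm
    calc ∫⁻ u, ∑ σ : Equiv.Perm (Fin n × Fin 2),
          {u | clockIndex n u = k}.indicator 1 (fun i => u (σ i)) ∂μ
        = ∫⁻ _, c k ∂μ := by
          refine lintegral_congr_ae ?_
          filter_upwards [ae_pi_unitMeasure_injective, ae_pi_unitMeasure_mem] with u hu hu1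
          simp only [c]
          rw [← card_perm_clockIndex_eq hn hu hw hu1 hw1, Finset.card_filter]
          push_cast
          refine Finset.sum_congr rfl fun σ _ => ?_
          simp [Set.indicator]
      _ = c k := by simp [μ]
  have hmain : ((2 * n)! : ENNReal) * ∫⁻ u, f (clockStop n u) ∂μ =
      (2 * n)! * ∑ k ∈ Finset.Icc 1 (2 * n), μ {u | clockIndex n u = k} *
          ∫⁻ t, f t * ENNReal.ofReal (normBernstein k (2 * n) t) ∂unitMeasure := by
    have hfc : Measurable fun u => f (clockStop n u) := hf.comp (measurable_clockStop n)
    rw [Finset.mul_sum, ← hcard,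
      factorial_mul_lintegral_eq_lintegral_sum_perm hfc, hcard]
    have hmr (k : ℕ) : Measurable (atRank (ι := Fin n × Fin 2) f k) :=
      Finset.measurable_sum _ fun i _ => measurable_ite_rankOf hf k i
    calc _ = ∫⁻ u, ∑ k ∈ Finset.Icc 1 (2 * n), c k * atRank f k u ∂μ := by
          refine lintegral_congr_ae ?_
          filter_upwards [ae_pi_unitMeasure_injective, ae_pi_unitMeasure_mem] with u hu hu1
          rw [sum_perm_clockStop hn f hu]
          simp only [card_perm_clockIndex_eq hn hu hw hu1 hw1, c]
      _ = _ := by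
          rw [lintegral_finsetSum _ fun k _ => (hmr k).const_mul _]
          refine Finset.sum_congr rfl fun k hk => ?_
          obtain ⟨hk1, hk2⟩ := Finset.mem_Icc.1 hk
          rw [lintegral_const_mul _ (hmr k), lintegral_atRank hf hk1 (hk2.trans_eq hcard.symm),
            hcard, hc, mul_assoc]
  exact (ENNReal.mul_right_inj hfac0 hfact).1 hmain

/-! ### Comparison of the two densities. -/

theorem continuous_normBernstein (k N : ℕ) : Continuous (normBernstein k N) := by
  unfold normBernstein
  fun_prop

theorem normBernstein_nonneg (k N : ℕ) {u : ℝ} (hu : u ∈ Set.Ico (0 : ℝ) 1) :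
    0 ≤ normBernstein k N u := by
  have h0 := hu.1
  have h1 : 0 ≤ 1 - u := by linarith [hu.2]
  unfold normBernstein
  positivity

theorem clockLaw_eq_withDensity_sum {n : ℕ} (hn : 1 ≤ n) :
    clockLaw n = unitMeasure.withDensity (fun t => ENNReal.ofReal
      (∑ k ∈ Finset.Icc 1 (2 * n),
        (Measure.pi (fun _ : Fin n × Fin 2 => unitMeasure)).real {u | clockIndex n u = k} *
          normBernstein k (2 * n) t)) := by
  let μ := Measure.pi (fun _ : Fin n × Fin 2 => unitMeasure)
  have hb (k : ℕ) : Measurable (normBernstein k (2 * n)) :=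
    (continuous_normBernstein k (2 * n)).measurable
  have hlaw : μ.map (clockStop n) = clockLaw n :=
    map_clockStop_eq_clockLaw n (Q := μ) (U := fun i u => u i) (fun i => measurable_pi_apply i)
      (fun i => (measurePreserving_eval (fun _ => unitMeasure) i).map_eq)
      (iIndepFun_pi (X := fun _ => id) fun _ => aemeasurable_id)
  rw [← hlaw]
  refine Measure.ext_of_lintegral _ fun f hf => ?_
  have hfb (k : ℕ) : Measurable fun t => f t * ENNReal.ofReal (normBernstein k (2 * n) t) :=
    hf.mul (hb k).ennreal_ofReal
  rw [lintegral_map hf (measurable_clockStop n), lintegral_clockStop hn hf,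
    lintegral_withDensity_eq_lintegral_mul _ (by fun_prop) hf]
  simp_rw [← lintegral_const_mul _ (hfb _)]
  rw [← lintegral_finsetSum _ fun k _ => (hfb k).const_mul _]
  refine lintegral_congr_ae ?_
  filter_upwards [ae_unitMeasure_mem] with t ht
  rw [Pi.mul_apply, ENNReal.ofReal_sum_of_nonneg fun k _ =>
    mul_nonneg measureReal_nonneg (normBernstein_nonneg k _ ht), Finset.sum_mul]
  refine Finset.sum_congr rfl fun k _ => ?_
  rw [ENNReal.ofReal_mul measureReal_nonneg, ofReal_measureReal]
  ring

/-- Densities of one measure agree almost everywhere; both are nonnegative, so `ENNReal.ofReal` can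
be removed, and continuity on an open set gives equality at every point. -/
theorem clockDensity_eq_sum {n : ℕ} (hn : 1 ≤ n) {u : ℝ} (hu : u ∈ Set.Ioo (0 : ℝ) 1) :
    clockDensity n u = ∑ k ∈ Finset.Icc 1 (2 * n),
        (Measure.pi (fun _ : Fin n × Fin 2 => unitMeasure)).real {u | clockIndex n u = k} *
          normBernstein k (2 * n) u := by
  have hb (k : ℕ) : Continuous (normBernstein k (2 * n)) := continuous_normBernstein k (2 * n)
  have hcont : Continuous fun t => ∑ k ∈ Finset.Icc 1 (2 * n),
        (Measure.pi (fun _ : Fin n × Fin 2 => unitMeasure)).real {u | clockIndex n u = k} *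
          normBernstein k (2 * n) t := by fun_prop
  have hd := continuous_clockDensity n
  have heq := (clockLaw_eq_withDensity hn).symm.trans (clockLaw_eq_withDensity_sum hn)
  rw [withDensity_eq_iff_of_sigmaFinite hd.measurable.ennreal_ofReal.aemeasurable
    hcont.measurable.ennreal_ofReal.aemeasurable] at heq
  have hae : clockDensity n =ᵐ[unitMeasure] fun t => ∑ k ∈ Finset.Icc 1 (2 * n),
        (Measure.pi (fun _ : Fin n × Fin 2 => unitMeasure)).real {u | clockIndex n u = k} *
          normBernstein k (2 * n) t := by
    filter_upwards [heq, ae_unitMeasure_mem] with t ht ht1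
    exact (ENNReal.ofReal_eq_ofReal_iff (clockDensity_nonneg hn t ht1)
      (Finset.sum_nonneg fun k _ =>
        mul_nonneg measureReal_nonneg (normBernstein_nonneg k _ ht1))).1 ht
  exact Measure.eqOn_open_of_ae_eq
    (ae_restrict_of_ae_restrict_of_subset Set.Ioo_subset_Ico_self hae)
    isOpen_Ioo hd.continuousOn hcont.continuousOn hu

theorem mainTheorem5 (n : ℕ) (hn : 1 ≤ n)
    {Ω : Type*} [MeasurableSpace Ω] (P : Measure Ω) [IsProbabilityMeasure P]
    (X : Fin n → Ω → ℝ) (hXm : ∀ i, Measurable (X i))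
    (hX : ∀ i, P.map (X i) = betaMeasure 1 2) (hXi : iIndepFun X P)
    {Ω' : Type*} [MeasurableSpace Ω'] (Q : Measure Ω') [IsProbabilityMeasure Q]
    (U : Fin n × Fin 2 → Ω' → ℝ) (hUm : ∀ ij, Measurable (U ij))
    (hU : ∀ ij, pdf.IsUniform (U ij) (Set.Ico (0 : ℝ) 1) Q volume) (hUi : iIndepFun U Q) :
    -- the function `1 - 2 ^ n * b_n` is the density on `(0,1)` of the fractional part of the sum
    (∀ u ∈ Set.Ioo (0 : ℝ) 1, 0 ≤ 1 - 2 ^ n * normBernoulli n u) ∧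
    P.map (fun ω => Int.fract (∑ i, X i ω)) =
      (volume.restrict (Set.Ioo (0 : ℝ) 1)).withDensity
        (fun u => ENNReal.ofReal (1 - 2 ^ n * normBernoulli n u)) ∧
    -- the index of the clock is a random variable with values in `{1, ..., 2n}`
    Measurable (fun ω => clockIndex n (fun ij => U ij ω)) ∧
    (∀ ω, clockIndex n (fun ij => U ij ω) ∈ Finset.Icc 1 (2 * n)) ∧
    -- the expansion of the density
    (∀ u ∈ Set.Ioo (0 : ℝ) 1,
      1 - 2 ^ n * normBernoulli n u =
        ∑ k ∈ Finset.Icc 1 (2 * n),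
          Q.real {ω | clockIndex n (fun ij => U ij ω) = k} * normBernstein k (2 * n) u) := by

  have hU' (ij) : Q.map (U ij) = unitMeasure := map_eq_unitMeasure_of_isUniform (hU ij)
  have hUm' : Measurable fun ω ij => U ij ω := measurable_pi_lambda _ hUm
  have hlaw : Q.map (fun ω ij => U ij ω) = Measure.pi fun _ : Fin n × Fin 2 => unitMeasure := by
    rw [(iIndepFun_iff_map_fun_eq_pi_map fun i => (hUm i).aemeasurable).1 hUi]
    simp_rw [hU']
  refine ⟨fun u hu => clockDensity_nonneg hn u ⟨hu.1.le, hu.2⟩, ?_,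
    (measurable_clockIndex n).comp hUm', fun ω => clockIndex_mem_Icc hn _, fun u hu => ?_⟩
  · rw [map_fract_sum_eq_clockLaw n hXm hX hXi, clockLaw_eq_withDensity hn, unitMeasure,
      restrict_Ioo_eq_restrict_Ico]
    rfl
  · refine (clockDensity_eq_sum hn hu).trans (Finset.sum_congr rfl fun k _ => ?_)
    have hk := map_measureReal_apply (μ := Q) hUm'
      (measurable_clockIndex n (measurableSet_singleton k))
    rw [hlaw] at hk
    exact congrArg (· * normBernstein k (2 * n) u) hk
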